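/- Let $\mathsf{Sup}$ be the category of complete lattices and maps preserving arbitrary suprema. A quantaloid is a category whose hom-sets are complete lattices and whose composition preserves arbitrary suprema in each variable; a homomorphism of quantaloids is a functor preserving arbitrary suprema of morphisms. Let $\mathcal Q$ be a small quantaloid and let $\mathsf{QUANT}(\mathcal Q^{\mathrm{op}},\mathsf{Sup})$ be the (large) quantaloid of right $\mathcal Q$-modules, i.e. of homomorphisms $\mathcal Q^{\mathrm{op}}\to\mathsf{Sup}$, with natural transformations, ordered componentwise, as morphisms. For a right $\mathcal Q$-module $\mathcal F$ the following are equivalent: 1. $\mathcal F$ is a projective object of $\mathsf{QUANT}(\mathcal Q^{\mathrm{op}},\mathsf{Sup})$, i.e. every morphism $\mathcal F\to\mathcal B$ factors through every epimorphism $\mathcal C\to\mathcal B$; 2. $\mathcal F$ is a retract of a direct sum (coproduct) $\bigoplus_{i\in I}\mathcal Q(-,X_i)$ of representable modules, for some set-indexed family $(X_i)_{i\in I}$ of objects of $\mathcal Q$; 3. $\mathcal F$ is small-projective, i.e. the representable homomorphism $\mathsf{QUANT}(\mathcal Q^{\mathrm{op}},\mathsf{Sup})(\mathcal F,-)\colon\mathsf{QUANT}(\mathcal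 Q^{\mathrm{op}},\mathsf{Sup})\to\mathsf{Sup}$ preserves all small weighted colimits. Here, for a small quantaloid $\mathcal R$, a weight $\Phi\colon\mathcal R^{\mathrm{op}}\to\mathsf{Sup}$ and a homomorphism $D\colon\mathcal R\to\mathcal K$ into a quantaloid, an object $C$ with $\eta\colon\Phi\to\mathcal K(D-,C)$ is the $\Phi$-weighted colimit of $D$ if for every object $E$ of $\mathcal K$ the map $\mathcal K(C,E)\to\mathsf{QUANT}(\mathcal R^{\mathrm{op}},\mathsf{Sup})(\Phi,\mathcal K(D-,E))$, $f\mapsto\mathcal K(D-,f)\circ\eta$, is an isomorphism in $\mathsf{Sup}$. -/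

import Mathlib

open CategoryTheory

universe w₁ w₂ v₁ v₂ u

/-- A quantaloid: a category whose hom-sets are complete lattices (suplattices), such that
composition preserves arbitrary suprema in each variable. -/
class Quantaloid (C : Type w₁) [Category.{v₁} C] where
  homLattice : ∀ X Y : C, CompleteLattice (X ⟶ Y)
  sSup_comp : ∀ {X Y Z : C} (S : Set (X ⟶ Y)) (g : Y ⟶ Z),
    sSup S ≫ g = sSup ((fun f : X ⟶ Y => f ≫ g) '' S)
  comp_sSup : ∀ {X Y Z : C} (f : X ⟶ Y) (S : Set (Y ⟶ Z)),
    f ≫ sSup S = sSup ((fun g : Y ⟶ Z => f ≫ g) '' S)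

attribute [reducible, instance] Quantaloid.homLattice

namespace Quantaloid

/-- Complete lattices, regarded as suplattices. -/
structure Sup : Type (u + 1) where
  carrier : Type u
  [lattice : CompleteLattice carrier]

attribute [instance] Sup.lattice

instance : CoeSort Sup.{u} (Type u) := ⟨Sup.carrier⟩

/-- Morphisms of suplattices: maps preserving arbitrary suprema. -/
instance : Category.{u} Sup.{u} where
  Hom L M := sSupHom L M
  id L := sSupHom.id L
  comp f g := sSupHom.comp g f

/-- Suprema of suplattice morphisms, computed pointwise. -/
def Sup.homSup {L M : Sup.{u}} (S : Set (L ⟶ M)) : L ⟶ M :=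
  { toFun := fun x => ⨆ f ∈ S, sSupHom.toFun f x
    map_sSup' := fun s => by
      simp only [sSupHom.map_sSup', sSup_image]
      rw [iSup_subtype', iSup_comm]
      simp only [iSup_subtype', iSup_comm (ι := ↥S)] : sSupHom L M }

/-- The pointwise order on suplattice morphisms, with its suprema. -/
abbrev Sup.homLattice (L M : Sup.{u}) : CompleteLattice (L ⟶ M) :=
  letI : PartialOrder (L ⟶ M) := inferInstanceAs (PartialOrder (sSupHom L M))
  letI : SupSet (L ⟶ M) := ⟨Sup.homSup⟩
  completeLatticeOfSup (L ⟶ M) fun S =>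
    ⟨fun f hf x => le_iSup₂ (f := fun (f : L ⟶ M) (_ : f ∈ S) => sSupHom.toFun f x) f hf,
      fun _ hg x => iSup₂_le fun _ hf => hg hf x⟩

/-- The quantaloid of suplattices. -/
instance : Quantaloid Sup.{u} where
  homLattice := Sup.homLattice
  sSup_comp {X Y Z} S g := by
    apply sSupHom.ext
    intro x
    change sSupHom.toFun g (⨆ f ∈ S, sSupHom.toFun f x) =
      ⨆ h ∈ (fun f : X ⟶ Y => f ≫ g) '' S, sSupHom.toFun h x
    rw [iSup_image]
    exact map_iSup₂ (show sSupHom Y Z from g) _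
  comp_sSup {X Y Z} f S := by
    apply sSupHom.ext
    intro x
    change (⨆ g ∈ S, sSupHom.toFun g (sSupHom.toFun f x)) =
      ⨆ h ∈ (fun g : Y ⟶ Z => f ≫ g) '' S, sSupHom.toFun h x
    rw [iSup_image]
    rfl

section Opposite

variable {C : Type w₁} [Category.{v₁} C] [Quantaloid C]

/-- The order on the hom-sets of the opposite category is that of `C`; it is not reversed. -/
abbrev opHomLattice (X Y : Cᵒᵖ) : CompleteLattice (X ⟶ Y) :=
  letI : PartialOrder (X ⟶ Y) := PartialOrder.lift Quiver.Hom.unop Quiver.Hom.unop_inj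
  letI : SupSet (X ⟶ Y) := ⟨fun S => (sSup (Quiver.Hom.unop '' S)).op⟩
  completeLatticeOfSup (X ⟶ Y) fun S => by
    constructor
    · intro f hf
      exact le_sSup (Set.mem_image_of_mem _ hf)
    · intro g hg
      refine sSup_le (α := Y.unop ⟶ X.unop) ?_
      rintro _ ⟨f, hf, rfl⟩
      exact hg hf

/-- The opposite quantaloid. -/
instance : Quantaloid Cᵒᵖ where
  homLattice := opHomLattice
  sSup_comp S g := by
    apply Quiver.Hom.unop_inj
    refine (Quantaloid.comp_sSup g.unop (Quiver.Hom.unop '' S)).trans ?_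
    change _ = sSup (Quiver.Hom.unop '' _)
    rw [Set.image_image, Set.image_image]
    rfl
  comp_sSup f S := by
    apply Quiver.Hom.unop_inj
    refine (Quantaloid.sSup_comp (Quiver.Hom.unop '' S) f.unop).trans ?_
    change _ = sSup (Quiver.Hom.unop '' _)
    rw [Set.image_image, Set.image_image]
    rfl

end Opposite

/-- A homomorphism of quantaloids: a functor preserving arbitrary suprema of morphisms. -/
structure QFunctor (A : Type w₁) [Category.{v₁} A] [Quantaloid A]
    (B : Type w₂) [Category.{v₂} B] [Quantaloid B] extends A ⥤ B where
  map_sSup : ∀ {X Y : A} (S : Set (X ⟶ Y)),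
    toFunctor.map (sSup S) = sSup ((fun f : X ⟶ Y => toFunctor.map f) '' S)

section FunctorQuantaloid

variable {A : Type w₁} [Category.{v₁} A] [Quantaloid A]
variable {B : Type w₂} [Category.{v₂} B] [Quantaloid B]

/-- The category `QUANT(A, B)`: its morphisms are the natural transformations. -/
instance : Category (QFunctor A B) where
  Hom F G := NatTrans F.toFunctor G.toFunctor
  id F := NatTrans.id F.toFunctor
  comp α β := NatTrans.vcomp α β

theorem QFunctor.hom_ext {F G : QFunctor A B} {α β : F ⟶ G}
    (h : ∀ X, NatTrans.app α X = NatTrans.app β X) : α = β :=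
  NatTrans.ext (funext h)

/-- Suprema of natural transformations are computed componentwise. -/
def QFunctor.homSup {F G : QFunctor A B} (S : Set (F ⟶ G)) : F ⟶ G :=
  { app := fun X => sSup ((fun α : F ⟶ G => NatTrans.app α X) '' S)
    naturality := fun X Y f => by
      rw [Quantaloid.comp_sSup, Quantaloid.sSup_comp, Set.image_image, Set.image_image]
      congr 1
      apply Set.image_congr
      intro α _
      exact NatTrans.naturality α f : NatTrans F.toFunctor G.toFunctor }

/-- The componentwise order on natural transformations, with its suprema. -/
abbrev QFunctor.homLattice (F G : QFunctor A B) : CompleteLattice (F ⟶ G) :=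
  letI : PartialOrder (F ⟶ G) :=
    PartialOrder.lift (fun α => fun X => NatTrans.app α X)
      fun _ _ h => QFunctor.hom_ext (congrFun h)
  letI : SupSet (F ⟶ G) := ⟨QFunctor.homSup⟩
  completeLatticeOfSup (F ⟶ G) fun S => by
    constructor
    · intro α hα X
      exact le_sSup (Set.mem_image_of_mem (fun α : F ⟶ G => NatTrans.app α X) hα)
    · intro β hβ X
      refine sSup_le (α := F.obj X ⟶ G.obj X) ?_
      rintro _ ⟨α, hα, rfl⟩
      exact hβ hα X

/-- The quantaloid `QUANT(A, B)` of homomorphisms from `A` to `B`. -/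
instance : Quantaloid (QFunctor A B) where
  homLattice := QFunctor.homLattice
  sSup_comp {F G H} S β := by
    apply QFunctor.hom_ext
    intro X
    refine (Quantaloid.sSup_comp ((fun α : F ⟶ G => NatTrans.app α X) '' S)
      (NatTrans.app β X)).trans ?_
    change _ = sSup ((fun α : F ⟶ H => NatTrans.app α X) '' _)
    rw [Set.image_image, Set.image_image]
    rfl
  comp_sSup {F G H} α S := by
    apply QFunctor.hom_ext
    intro X
    refine (Quantaloid.comp_sSup (NatTrans.app α X)
      ((fun β : G ⟶ H => NatTrans.app β X) '' S)).trans ?_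
    change _ = sSup ((fun α : F ⟶ H => NatTrans.app α X) '' _)
    rw [Set.image_image, Set.image_image]
    rfl

end FunctorQuantaloid

/-- The quantaloid `QUANT(Qᵒᵖ, Sup)` of right `Q`-modules. -/
abbrev RightModule (Q : Type u) [Category.{u} Q] [Quantaloid Q] : Type (u + 1) :=
  QFunctor Qᵒᵖ Sup.{u}

section Representables

variable {C : Type w₁} [Category.{u} C] [Quantaloid C]

/-- Precomposition with `f`, as a suplattice morphism `C(Y, Z) → C(X, Z)`. -/
def precomp {X Y : C} (f : X ⟶ Y) (Z : C) : sSupHom (Y ⟶ Z) (X ⟶ Z) where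
  toFun g := f ≫ g
  map_sSup' S := Quantaloid.comp_sSup f S

/-- Postcomposition with `g`, as a suplattice morphism `C(X, Y) → C(X, Z)`. -/
def postcomp (X : C) {Y Z : C} (g : Y ⟶ Z) : sSupHom (X ⟶ Y) (X ⟶ Z) where
  toFun f := f ≫ g
  map_sSup' S := Quantaloid.sSup_comp S g

/-- The covariant representable homomorphism `C(X, -) : C → Sup`. -/
def homFrom (X : C) : QFunctor C Sup.{u} where
  obj Y := ⟨X ⟶ Y⟩
  map g := postcomp X g
  map_id Y := sSupHom.ext fun f => Category.comp_id f
  map_comp g h := sSupHom.ext fun f => (Category.assoc f g h).symm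
  map_sSup {Y Z} S := by
    apply sSupHom.ext
    intro f
    change f ≫ sSup S = ⨆ h ∈ (fun g : Y ⟶ Z => postcomp X g) '' S, sSupHom.toFun h f
    rw [Quantaloid.comp_sSup, sSup_image, iSup_image]
    rfl

/-- The contravariant representable homomorphism `C(-, X) : Cᵒᵖ → Sup`. -/
def homInto (X : C) : QFunctor Cᵒᵖ Sup.{u} where
  obj Y := ⟨Y.unop ⟶ X⟩
  map f := precomp f.unop X
  map_id Y := sSupHom.ext fun f => Category.id_comp f
  map_comp f g := sSupHom.ext fun h => Category.assoc g.unop f.unop h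
  map_sSup {Y Z} S := by
    apply sSupHom.ext
    intro f
    change sSup (Quiver.Hom.unop '' S) ≫ f =
      ⨆ h ∈ (fun g : Y ⟶ Z => precomp g.unop X) '' S, sSupHom.toFun h f
    rw [Quantaloid.sSup_comp, Set.image_image, sSup_image, iSup_image]
    rfl

end Representables

section WeightedColimits

variable {R : Type u} [Category.{u} R] [Quantaloid R]
variable {K : Type w₁} [Category.{u} K] [Quantaloid K]
variable {L : Type w₂} [Category.{u} L] [Quantaloid L]

/-- Composition of quantaloid homomorphisms. -/
def QFunctor.comp (D : QFunctor R K) (G : QFunctor K L) : QFunctor R L where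
  toFunctor := D.toFunctor ⋙ G.toFunctor
  map_sSup S := by
    change G.map (D.map (sSup S)) = _
    rw [D.map_sSup, G.map_sSup, Set.image_image]
    rfl

/-- The presheaf `K(D-, E) : Rᵒᵖ → Sup`. -/
def homAlong (D : QFunctor R K) (E : K) : QFunctor Rᵒᵖ Sup.{u} where
  toFunctor := D.toFunctor.op ⋙ (homInto E).toFunctor
  map_sSup {X Y} S := by
    apply sSupHom.ext
    intro (f : D.obj X.unop ⟶ E)
    change D.map (sSup (Quiver.Hom.unop '' S)) ≫ f =
      ⨆ h ∈ (fun g : X ⟶ Y => precomp (D.map g.unop) E) '' S, sSupHom.toFun h f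
    rw [D.map_sSup, Quantaloid.sSup_comp, Set.image_image, Set.image_image, sSup_image,
      iSup_image]
    rfl

/-- The transformation `K(D-, f) : K(D-, E) → K(D-, E')` given by composition with
`f : E → E'`. -/
def homAlongMap (D : QFunctor R K) {E E' : K} (f : E ⟶ E') :
    homAlong D E ⟶ homAlong D E' :=
  { app := fun X => postcomp (D.obj X.unop) f
    naturality := fun _ _ g => sSupHom.ext fun h => Category.assoc (D.map g.unop) h f :
    NatTrans (homAlong D E).toFunctor (homAlong D E').toFunctor }

/-- The action of a quantaloid homomorphism on a hom-suplattice. -/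
def QFunctor.mapHom (G : QFunctor K L) (X Y : K) :
    sSupHom (X ⟶ Y) (G.obj X ⟶ G.obj Y) where
  toFun f := G.map f
  map_sSup' S := G.map_sSup S

/-- The transformation `K(D-, E) → L(GD-, GE)` given by the action of `G`. -/
def homAlongApply (D : QFunctor R K) (G : QFunctor K L) (E : K) :
    homAlong D E ⟶ homAlong (D.comp G) (G.obj E) :=
  { app := fun X => G.mapHom (D.obj X.unop) E
    naturality := fun _ _ g => sSupHom.ext fun h => G.map_comp (D.map g.unop) h :
    NatTrans (homAlong D E).toFunctor (homAlong (D.comp G) (G.obj E)).toFunctor }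

/-- The object `c` together with the unit `η : Φ → K(D-, c)` is a colimit of `D : R → K` weighted
by `Φ : Rᵒᵖ → Sup`: for every `E`, the supremum-preserving map
`K(c, E) → QUANT(Rᵒᵖ, Sup)(Φ, K(D-, E))` that `η` induces is bijective, that is, an isomorphism
of suplattices (automatically natural in `E`). -/
def IsWeightedColimit (Φ : QFunctor Rᵒᵖ Sup.{u}) (D : QFunctor R K) (c : K)
    (η : Φ ⟶ homAlong D c) : Prop :=
  ∀ E : K, Function.Bijective fun f : c ⟶ E => (η ≫ homAlongMap D f : Φ ⟶ homAlong D E)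

/-- `G` preserves all small weighted colimits (those which exist in `K`): it sends each colimiting
unit `Φ → K(D-, c)`, with `D` defined on a small quantaloid, to a colimiting unit
`Φ → K(D-, c) → L(GD-, Gc)`. -/
def PreservesSmallWeightedColimits (G : QFunctor K L) : Prop :=
  ∀ (R : Type u) [Category.{u} R] [Quantaloid R] (Φ : QFunctor Rᵒᵖ Sup.{u})
    (D : QFunctor R K) (c : K) (η : Φ ⟶ homAlong D c),
    IsWeightedColimit Φ D c η →
      IsWeightedColimit Φ (D.comp G) (G.obj c) (η ≫ homAlongApply D G c)

/-- An object is small-projective when its covariant representable homomorphism preserves all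
small weighted colimits. -/
def IsSmallProjective (P : K) : Prop :=
  PreservesSmallWeightedColimits (homFrom P)

end WeightedColimits

/-- `F` is a retract of a direct sum of a set-indexed family of representable modules. -/
def IsRetractOfSumOfRepresentables {Q : Type u} [Category.{u} Q] [Quantaloid Q]
    (F : RightModule Q) : Prop :=
  ∃ (I : Type u) (X : I → Q) (S : Limits.Cofan fun i => (homInto (X i) : RightModule Q)),
    Nonempty (Limits.IsColimit S) ∧ Nonempty (Retract F S.pt)

end Quantaloid

/-! All three conditions are equivalent to `HasDualBasis`: the identity of `F` is a supremum of
composites `F ⟶ Q(-, X i) ⟶ F`.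

For retracts, suprema of morphisms make products and coproducts coincide, so a sum of representables
has projections `p i` with `⨆ i, p i ≫ inj i = 𝟙` (`exists_iSup_comp_inj_eq_id`). Conjugating by the
retraction gives a dual basis; conversely, a dual basis assembles into a section and a retraction.

For projectivity, epimorphisms of modules are surjective (`surjective_of_epi`), so a lift can be
chosen on each representable and the choices glued by the dual basis. Conversely, every module is an
epimorphic image of the sum of representables indexed by its elements.

For small-projectivity, evaluation at `X` has a right adjoint, coinduction, so representables are
small-projective (`isSmallProjective_homInto`), and a dual basis transfers this to `F`. Conversely,
`F` is the `F`-weighted colimit of the Yoneda embedding. If this is preserved, maps out of `End(F)`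
are determined by their values on endomorphisms factoring through a representable, and testing
against the two-element lattice shows that `𝟙` is a supremum of these. -/

namespace Quantaloid

/-! ### Suprema of morphisms and biproducts in a quantaloid -/

section General

variable {K : Type w₁} [Category.{v₁} K] [Quantaloid K]

theorem comp_iSup {ι : Sort*} {X Y Z : K} (f : X ⟶ Y) (g : ι → (Y ⟶ Z)) :
    f ≫ (⨆ i, g i) = ⨆ i, f ≫ g i := by
  rw [iSup, comp_sSup, ← Set.range_comp]
  rfl

theorem iSup_comp {ι : Sort*} {X Y Z : K} (f : ι → (X ⟶ Y)) (g : Y ⟶ Z) :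
    (⨆ i, f i) ≫ g = ⨆ i, f i ≫ g := by
  rw [iSup, sSup_comp, ← Set.range_comp]
  rfl

theorem comp_bot {X Y Z : K} (f : X ⟶ Y) : f ≫ (⊥ : Y ⟶ Z) = ⊥ := by
  simpa using comp_sSup f (∅ : Set (Y ⟶ Z))

theorem bot_comp {X Y Z : K} (g : Y ⟶ Z) : (⊥ : X ⟶ Y) ≫ g = ⊥ := by
  simpa using sSup_comp (∅ : Set (X ⟶ Y)) g

open Classical in
/-- The Kronecker delta of a family of objects of a quantaloid. -/
noncomputable def kronecker {I : Type*} (P : I → K) (i j : I) : P i ⟶ P j :=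
  if h : i = j then eqToHom (congrArg P h) else ⊥

theorem kronecker_self {I : Type*} (P : I → K) (i : I) : kronecker P i i = 𝟙 (P i) := by
  simp [kronecker]

theorem iSup_kronecker_comp {I : Type*} (P : I → K) {Y : K} (g : ∀ i, P i ⟶ Y) (j : I) :
    ⨆ i, kronecker P j i ≫ g i = g j := by
  apply le_antisymm
  · refine iSup_le fun i => ?_
    by_cases h : j = i
    · subst h; rw [kronecker_self, Category.id_comp]
    · rw [kronecker, dif_neg h, bot_comp]; exact bot_le
  · refine le_trans (le_of_eq ?_) (le_iSup _ j)
    rw [kronecker_self, Category.id_comp]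

theorem iSup_comp_kronecker {I : Type*} (P : I → K) {Y : K} (g : ∀ i, Y ⟶ P i) (j : I) :
    ⨆ i, g i ≫ kronecker P i j = g j := by
  apply le_antisymm
  · refine iSup_le fun i => ?_
    by_cases h : i = j
    · subst h; rw [kronecker_self, Category.comp_id]
    · rw [kronecker, dif_neg h, comp_bot]; exact bot_le
  · refine le_trans (le_of_eq ?_) (le_iSup _ j)
    rw [kronecker_self, Category.comp_id]

/-- A coproduct in a quantaloid carries projections whose composites with the injections have
the identity as their supremum. -/
theorem exists_iSup_comp_inj_eq_id {I : Type*} {P : I → K} {S : Limits.Cofan P}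
    (hS : Limits.IsColimit S) :
    ∃ p : ∀ i, S.pt ⟶ P i, ⨆ i, p i ≫ S.inj i = 𝟙 S.pt := by
  -- The `i`-th projection is the identity on the `i`-th summand and `⊥` on the others.
  refine ⟨fun i => Limits.Cofan.IsColimit.desc hS fun j => kronecker P j i, ?_⟩
  refine Limits.Cofan.IsColimit.hom_ext hS _ _ fun j => ?_
  rw [comp_iSup, Category.comp_id]
  refine Eq.trans (iSup_congr fun i => ?_) (iSup_kronecker_comp P S.inj j)
  rw [← Category.assoc, Limits.Cofan.IsColimit.fac]

/-- A product in a quantaloid is also a coproduct. -/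
noncomputable def isColimitOfIsProduct {I : Type*} {P : I → K} {S : Limits.Fan P}
    (hS : Limits.IsLimit S) :
    Limits.IsColimit (Limits.Cofan.mk S.pt fun i =>
      Limits.Fan.IsLimit.lift hS fun j => kronecker P i j) := by
  refine Limits.Cofan.IsColimit.mk _ (fun s => ⨆ i, S.proj i ≫ s.inj i) ?_ ?_
  · intro s j
    change Limits.Fan.IsLimit.lift hS _ ≫ _ = _
    rw [comp_iSup]
    refine Eq.trans (iSup_congr fun i => ?_) (iSup_kronecker_comp P s.inj j)
    rw [← Category.assoc, Limits.Fan.IsLimit.fac]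
  · intro s m hm
    -- The identity decomposes through the factors, so `m` is recovered from its restrictions along
    -- the injections; this gives uniqueness.
    have key : ⨆ i, S.proj i ≫ (Limits.Fan.IsLimit.lift hS fun j => kronecker P i j) = 𝟙 S.pt := by
      refine Limits.Fan.IsLimit.hom_ext hS _ _ fun j => ?_
      rw [iSup_comp, Category.id_comp]
      refine Eq.trans (iSup_congr fun i => ?_) (iSup_comp_kronecker P S.proj j)
      rw [Category.assoc, Limits.Fan.IsLimit.fac]
    refine ((Category.id_comp m).symm.trans (congrArg (· ≫ m) key.symm)).trans ?_
    refine (iSup_comp _ m).trans (iSup_congr fun i => ?_)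
    rw [Category.assoc, ← hm i]
    rfl

end General

/-! ### Suplattice maps into the two-element lattice -/

section Suplattices

theorem Sup.iSup_apply {L M : Sup.{u}} {ι : Sort*} (f : ι → (L ⟶ M)) (x : L) :
    sSupHom.toFun (⨆ i, f i : L ⟶ M) x = ⨆ i, sSupHom.toFun (f i) x := by
  change (⨆ g ∈ Set.range f, sSupHom.toFun g x) = _
  rw [iSup_range]

theorem Sup.sSup_apply {L M : Sup.{u}} (S : Set (L ⟶ M)) (x : L) :
    sSupHom.toFun (sSup S : L ⟶ M) x = sSup ((fun f : L ⟶ M => sSupHom.toFun f x) '' S) := by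
  rw [sSup_image]
  rfl

/-- The map `x ↦ ¬ x ≤ b` into the two-element lattice. -/
def Sup.notLe {L : Sup.{u}} (b : L) : L ⟶ (⟨ULift.{u} Prop⟩ : Sup.{u}) :=
  { toFun := fun x => ⟨¬ x ≤ b⟩
    map_sSup' := fun s => by
      apply ULift.down_injective
      rw [ULift.down_sSup]
      simp only [sSup_le_iff, not_forall, sSup_Prop_eq]
      exact propext ⟨fun ⟨x, hx, h⟩ => ⟨_, ⟨x, hx, rfl⟩, h⟩, fun ⟨_, ⟨x, hx, h⟩, hp⟩ =>
        ⟨x, hx, (congrArg ULift.down h).mpr hp⟩⟩ : sSupHom L (ULift.{u} Prop) }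

/-- Turns equality of test maps into an equivalence of inequalities; at `x = x' = b` it yields `b ≤
b'`. -/
theorem Sup.notLe_eq_iff {L : Sup.{u}} {b b' x x' : L} :
    sSupHom.toFun (Sup.notLe b) x = sSupHom.toFun (Sup.notLe b') x' ↔ (x ≤ b ↔ x' ≤ b') := by
  change ULift.up _ = ULift.up _ ↔ _
  rw [ULift.up_inj, eq_iff_iff, not_iff_not]

end Suplattices

/-! ### Elements of modules and the Yoneda lemma -/

namespace RightModule

variable {Q : Type u} [Category.{u} Q] [Quantaloid Q]

/-- The action of a morphism `f : X ⟶ Y` on an element of `M` at `Y`. -/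
def act (M : RightModule Q) {X Y : Q} (f : X ⟶ Y) (m : M.obj (.op Y)) : M.obj (.op X) :=
  sSupHom.toFun (M.map f.op) m

/-- The value of a module morphism at an element. -/
def ap {M N : RightModule Q} (α : M ⟶ N) {X : Q} (m : M.obj (.op X)) : N.obj (.op X) :=
  sSupHom.toFun (NatTrans.app α (.op X)) m

theorem id_act (M : RightModule Q) {X : Q} (m : M.obj (.op X)) : M.act (𝟙 X) m = m :=
  congrArg (fun k => sSupHom.toFun k m) (M.map_id (.op X))

theorem act_act (M : RightModule Q) {X Y Z : Q} (f : X ⟶ Y) (g : Y ⟶ Z) (m : M.obj (.op Z)) :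
    M.act f (M.act g m) = M.act (f ≫ g) m :=
  (congrArg (fun k => sSupHom.toFun k m) (M.map_comp g.op f.op)).symm

theorem act_sSup (M : RightModule Q) {X Y : Q} (f : X ⟶ Y) (s : Set (M.obj (.op Y))) :
    M.act f (sSup s) = sSup (M.act f '' s) :=
  sSupHom.map_sSup' _ s

theorem sSup_act (M : RightModule Q) {X Y : Q} (s : Set (X ⟶ Y)) (m : M.obj (.op Y)) :
    M.act (sSup s) m = sSup ((fun f => M.act f m) '' s) := by
  -- Suprema in `Qᵒᵖ` are defined through images under `unop`, so `s` is first written as such an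
  -- image.
  have h : (sSup s).op = sSup (Quiver.Hom.unop ⁻¹' s) := by
    apply Quiver.Hom.unop_inj
    change sSup s = sSup (Quiver.Hom.unop '' _)
    rw [Set.image_preimage_eq s fun f => ⟨f.op, rfl⟩]
  rw [act, h, M.map_sSup, Sup.sSup_apply, Set.image_image]
  congr 1
  ext x
  exact ⟨fun ⟨f, hf, e⟩ => ⟨f.unop, hf, e⟩, fun ⟨f, hf, e⟩ => ⟨f.op, hf, e⟩⟩

theorem hom_ext {M N : RightModule Q} {α β : M ⟶ N}
    (h : ∀ (X : Q) (m : M.obj (.op X)), ap α m = ap β m) : α = β :=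
  QFunctor.hom_ext fun X => sSupHom.ext (h X.unop)

theorem ap_act {M N : RightModule Q} (α : M ⟶ N) {X Y : Q} (f : X ⟶ Y) (m : M.obj (.op Y)) :
    ap α (M.act f m) = N.act f (ap α m) :=
  congrArg (fun k => sSupHom.toFun k m) (NatTrans.naturality α f.op)

theorem ap_sSup {M N : RightModule Q} (α : M ⟶ N) {X : Q} (s : Set (M.obj (.op X))) :
    ap α (sSup s) = sSup (ap α '' s) :=
  sSupHom.map_sSup' _ s

theorem sSup_ap {M N : RightModule Q} (s : Set (M ⟶ N)) {X : Q} (m : M.obj (.op X)) :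
    ap (sSup s) m = sSup ((fun α => ap α m) '' s) := by
  refine (Sup.sSup_apply _ m).trans ?_
  rw [Set.image_image]
  rfl

/-- The morphism out of a representable module that corresponds to an element. -/
def ofElement (M : RightModule Q) {X : Q} (m : M.obj (.op X)) : homInto X ⟶ M :=
  { app := fun Y =>
      { toFun := fun f => M.act f m
        map_sSup' := fun s => M.sSup_act s m : sSupHom (Y.unop ⟶ X) (M.obj Y) }
    naturality := fun _ _ g => sSupHom.ext fun f => (M.act_act g.unop f m).symm :
    NatTrans (homInto X).toFunctor M.toFunctor }

/-- The element corresponding to a morphism out of a representable module. -/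
def element {M : RightModule Q} {X : Q} (α : homInto X ⟶ M) : M.obj (.op X) :=
  ap α (X := X) (𝟙 X)

theorem element_ofElement (M : RightModule Q) {X : Q} (m : M.obj (.op X)) :
    element (M.ofElement m) = m := M.id_act m

theorem element_comp {M N : RightModule Q} {X : Q} (α : homInto X ⟶ M) (β : M ⟶ N) :
    element (α ≫ β) = ap β (element α) := rfl

theorem element_sSup {M : RightModule Q} {X : Q} (s : Set (homInto X ⟶ M)) :
    element (sSup s) = sSup (element '' s) := sSup_ap s (X := X) (𝟙 X)

theorem ofElement_element {M : RightModule Q} {X : Q} (α : homInto X ⟶ M) :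
    M.ofElement (element α) = α := by
  refine hom_ext fun Y (f : Y ⟶ X) => ?_
  have h : ap α (X := Y) (f ≫ 𝟙 X) = M.act f (ap α (X := X) (𝟙 X)) := ap_act α f _
  rw [Category.comp_id] at h
  exact h.symm

theorem ofElement_comp {M N : RightModule Q} {X : Q} (m : M.obj (.op X)) (α : M ⟶ N) :
    M.ofElement m ≫ α = N.ofElement (ap α m) :=
  hom_ext fun _ f => ap_act α f m

/-- The morphism of representable modules given by postcomposition. -/
def representableMap {X Y : Q} (f : X ⟶ Y) : (homInto X : RightModule Q) ⟶ homInto Y :=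
  ofElement (homInto Y) (X := X) f

theorem ofElement_act (M : RightModule Q) {X Y : Q} (f : X ⟶ Y) (m : M.obj (.op Y)) :
    M.ofElement (M.act f m) = representableMap f ≫ M.ofElement m :=
  (ofElement_comp (M := homInto Y) (X := X) f (M.ofElement m)).symm

theorem element_representableMap_comp {M : RightModule Q} {X Y : Q} (f : X ⟶ Y)
    (α : homInto Y ⟶ M) : element (representableMap f ≫ α) = M.act f (element α) := by
  conv_lhs => rw [← ofElement_element α, ← ofElement_act, element_ofElement]

theorem ofElement_sSup (M : RightModule Q) {X : Q} (s : Set (M.obj (.op X))) :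
    M.ofElement (sSup s) = sSup (M.ofElement '' s) := by
  refine hom_ext fun Y f => ?_
  rw [sSup_ap, Set.image_image]
  exact M.act_sSup f s

/-! ### Coinduction, right adjoint to evaluation at an object -/

/-- The module coinduced by a suplattice: the value at `Z` is the suplattice of maps from
`Q(X, Z)` to `E`. -/
abbrev coinduced (X : Q) (E : Sup.{u}) : RightModule Q := homAlong (homFrom X) E

/-- The morphism into a coinduced module that corresponds to a suplattice map. -/
def toCoinduced (M : RightModule Q) {X : Q} {E : Sup.{u}} (k : M.obj (.op X) ⟶ E) :
    M ⟶ coinduced X E :=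
  { app := fun Z =>
      { toFun := fun m =>
          { toFun := fun q => sSupHom.toFun k (M.act q m)
            map_sSup' := fun s => by
              rw [sSup_act, sSupHom.map_sSup', Set.image_image] : sSupHom (X ⟶ Z.unop) E }
        map_sSup' := fun s => by
          apply sSupHom.ext
          intro (q : X ⟶ Z.unop)
          refine Eq.trans ?_ (Sup.sSup_apply (L := ⟨X ⟶ Z.unop⟩) _ q).symm
          rw [Set.image_image]
          refine (congrArg (sSupHom.toFun k) (M.act_sSup q s)).trans ?_
          rw [sSupHom.map_sSup', Set.image_image] :
        sSupHom (M.obj Z) ((⟨X ⟶ Z.unop⟩ : Sup.{u}) ⟶ E) }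
    naturality := fun Y Z g => by
      apply sSupHom.ext
      intro m
      apply sSupHom.ext
      intro q
      exact congrArg (sSupHom.toFun k) (M.act_act q g.unop m) :
    NatTrans M.toFunctor (coinduced X E).toFunctor }

/-- Evaluation of an element of the coinduced module at the identity. -/
def coinducedCounit (X : Q) (E : Sup.{u}) : (coinduced X E).obj (.op X) ⟶ E :=
  { toFun := fun k => sSupHom.toFun k (𝟙 X)
    map_sSup' := fun s => Sup.sSup_apply (L := ⟨X ⟶ X⟩) s (𝟙 X) :
    sSupHom ((coinduced X E).obj (.op X)) E }

/-- The suplattice map that corresponds to a morphism into a coinduced module. -/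
def ofCoinduced {M : RightModule Q} {X : Q} {E : Sup.{u}} (α : M ⟶ coinduced X E) :
    M.obj (.op X) ⟶ E :=
  NatTrans.app α (.op X) ≫ coinducedCounit X E

theorem ofCoinduced_toCoinduced (M : RightModule Q) {X : Q} {E : Sup.{u}}
    (k : M.obj (.op X) ⟶ E) : ofCoinduced (M.toCoinduced k) = k :=
  sSupHom.ext fun m => congrArg (sSupHom.toFun k) (M.id_act m)

theorem comp_ofCoinduced {M N : RightModule Q} {X : Q} {E : Sup.{u}} (α : M ⟶ N)
    (β : N ⟶ coinduced X E) (m : M.obj (.op X)) :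
    sSupHom.toFun (ofCoinduced (α ≫ β)) m = sSupHom.toFun (ofCoinduced β) (ap α m) := rfl

theorem ofCoinduced_sSup {M : RightModule Q} {X : Q} {E : Sup.{u}}
    (s : Set (M ⟶ coinduced X E)) : ofCoinduced (sSup s) = sSup (ofCoinduced '' s) := by
  change sSup _ ≫ _ = _
  rw [sSup_comp, Set.image_image]
  rfl

/-- By naturality, the value of `γ` at `m` and `q` is the value of its transpose at `q` acting on
`m`. -/
theorem ofCoinduced_injective {M : RightModule Q} {X : Q} {E : Sup.{u}} :
    Function.Injective (ofCoinduced : (M ⟶ coinduced X E) → (M.obj (.op X) ⟶ E)) := by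
  intro α β h
  refine hom_ext fun Y m => sSupHom.ext fun (q : X ⟶ Y) => ?_
  have key : ∀ γ : M ⟶ coinduced X E,
      sSupHom.toFun (ap γ m) q = sSupHom.toFun (ofCoinduced γ) (M.act q m) := fun γ => by
    change _ = sSupHom.toFun (coinducedCounit X E) (ap γ (M.act q m))
    rw [ap_act]
    exact congrArg (sSupHom.toFun (ap γ m)) (Category.id_comp q).symm
  exact (key α).trans ((congrArg (fun k => sSupHom.toFun k (M.act q m)) h).trans (key β).symm)

theorem toCoinduced_sSup (M : RightModule Q) {X : Q} {E : Sup.{u}}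
    (s : Set (M.obj (.op X) ⟶ E)) : M.toCoinduced (sSup s) = sSup (M.toCoinduced '' s) := by
  apply ofCoinduced_injective
  rw [ofCoinduced_sSup, ofCoinduced_toCoinduced, Set.image_image]
  simp_rw [ofCoinduced_toCoinduced]
  rw [Set.image_id']

/-- Coinduced modules carry enough test maps: were `b` missed, two maps out of `N` would differ at
`b` but agree after `e`. -/
theorem surjective_of_epi {M N : RightModule Q} (e : M ⟶ N) [Epi e] (X : Q) :
    Function.Surjective fun m : M.obj (.op X) => ap e m := by
  intro b
  -- The largest element whose image lies below `b`; on the image of `e`, lying below `b` and lying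
  -- below `ap e m` are the same.
  let m := sSup {m : M.obj (.op X) | ap e m ≤ b}
  have hm : ap e m ≤ b := by
    rw [ap_sSup]
    exact sSup_le fun _ ⟨_, hc, h⟩ => h ▸ hc
  have hle : ∀ c : M.obj (.op X), ap e c ≤ b ↔ ap e c ≤ ap e m := by
    refine fun c => ⟨fun h => ?_, fun h => h.trans hm⟩
    change _ ≤ ap e (sSup _)
    rw [ap_sSup]
    exact le_sSup ⟨c, h, rfl⟩
  have h : N.toCoinduced (Sup.notLe b) = N.toCoinduced (Sup.notLe (ap e m)) := by
    rw [← cancel_epi e]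
    refine ofCoinduced_injective (sSupHom.ext fun c => ?_)
    change sSupHom.toFun (ofCoinduced _) c = sSupHom.toFun (ofCoinduced _) c
    rw [comp_ofCoinduced, comp_ofCoinduced, ofCoinduced_toCoinduced, ofCoinduced_toCoinduced,
      Sup.notLe_eq_iff]
    exact hle c
  have h' := congrArg (fun α => sSupHom.toFun (ofCoinduced α) b) h
  simp only [ofCoinduced_toCoinduced] at h'
  exact ⟨m, le_antisymm hm ((Sup.notLe_eq_iff.mp h').mp le_rfl)⟩

/-! ### Products of modules -/

/-- The pointwise product of a family of modules. -/
def pi {I : Type u} (P : I → RightModule Q) : RightModule Q where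
  obj Y := ⟨∀ i, (P i).obj Y⟩
  map {Y Z} g :=
    { toFun := fun m i => sSupHom.toFun ((P i).map g) (m i)
      map_sSup' := fun s => by
        funext i
        rw [sSup_apply_eq_sSup_image, sSup_apply_eq_sSup_image, sSupHom.map_sSup',
          Set.image_image, Set.image_image] :
      sSupHom (∀ i, (P i).obj Y) (∀ i, (P i).obj Z) }
  map_id Y := sSupHom.ext fun m => funext fun i => (P i).id_act (m i)
  map_comp f g := sSupHom.ext fun m => funext fun i => ((P i).act_act g.unop f.unop (m i)).symm
  map_sSup {Y Z} S := by
    apply sSupHom.ext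
    intro m
    refine Eq.trans ?_ (Sup.sSup_apply (L := ⟨∀ i, (P i).obj Y⟩) (M := ⟨∀ i, (P i).obj Z⟩)
      _ m).symm
    funext i
    rw [sSup_apply_eq_sSup_image, Set.image_image, Set.image_image]
    change sSupHom.toFun ((P i).map (sSup S)) (m i) = _
    rw [(P i).map_sSup, Sup.sSup_apply, Set.image_image]

/-- The projections of the pointwise product. -/
def piFan {I : Type u} (P : I → RightModule Q) : Limits.Fan P :=
  Limits.Fan.mk (pi P) fun i =>
    { app := fun Y =>
        { toFun := fun m => m i
          map_sSup' := fun s => by rw [sSup_apply_eq_sSup_image] :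
          sSupHom (∀ i, (P i).obj Y) ((P i).obj Y) }
      naturality := fun _ _ _ => rfl : NatTrans (pi P).toFunctor (P i).toFunctor }

/-- The pointwise product is a product of modules. -/
def piFanIsLimit {I : Type u} (P : I → RightModule Q) : Limits.IsLimit (piFan P) :=
  Limits.Fan.IsLimit.mk _
    (fun s =>
      { app := fun Y =>
          { toFun := fun m i => sSupHom.toFun (NatTrans.app (s.proj i) Y) m
            map_sSup' := fun t => by
              funext i
              rw [sSup_apply_eq_sSup_image, sSupHom.map_sSup', Set.image_image] :
            sSupHom (s.pt.obj Y) (∀ i, (P i).obj Y) }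
        naturality := fun Y Z g => sSupHom.ext fun m => funext fun i =>
          ap_act (s.proj i) g.unop m :
        NatTrans s.pt.toFunctor (pi P).toFunctor })
    (fun _ _ => rfl)
    (fun s m hm => hom_ext fun Y x => funext fun i =>
      congrArg (fun α : s.pt ⟶ P i => ap α x) (hm i))

end RightModule

/-! ### Small-projectivity through a decomposition of the identity -/

section SmallProjective

variable {R : Type u} [Category.{u} R] [Quantaloid R]
variable {K : Type w₁} [Category.{u} K] [Quantaloid K]

/-- The transformation `Sup(K(P', D-), E) → Sup(K(P, D-), E)` induced by `b : P ⟶ P'`. -/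
def homAlongPrecomp (D : QFunctor R K) {P P' : K} (b : P ⟶ P') (E : Sup.{u}) :
    homAlong (D.comp (homFrom P)) E ⟶ homAlong (D.comp (homFrom P')) E :=
  { app := fun r => precomp (C := Sup.{u})
      (X := (homFrom P').obj (D.obj r.unop)) (Y := (homFrom P).obj (D.obj r.unop))
      (precomp b (D.obj r.unop)) E
    naturality := fun r s g => by
      apply sSupHom.ext
      intro k
      apply sSupHom.ext
      intro h
      exact congrArg (sSupHom.toFun k) (Category.assoc b h (D.map g.unop)) :
    NatTrans (homAlong (D.comp (homFrom P)) E).toFunctor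
      (homAlong (D.comp (homFrom P')) E).toFunctor }

/-- The value of a transformation `Φ → Sup(K(P, D-), E)` at `φ` and `h : P ⟶ D r`. -/
def coneValue {Φ : QFunctor Rᵒᵖ Sup.{u}} {D : QFunctor R K} {P : K} {E : Sup.{u}}
    (θ : Φ ⟶ homAlong (D.comp (homFrom P)) E) {r : R} (φ : Φ.obj (.op r)) :
    sSupHom (P ⟶ D.obj r) E :=
  (sSupHom.toFun (NatTrans.app θ (.op r)) φ : (⟨P ⟶ D.obj r⟩ : Sup.{u}) ⟶ E)

theorem cone_ext {Φ : QFunctor Rᵒᵖ Sup.{u}} {D : QFunctor R K} {P : K} {E : Sup.{u}}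
    {θ θ' : Φ ⟶ homAlong (D.comp (homFrom P)) E}
    (h : ∀ (r : R) (φ : Φ.obj (.op r)) (k : P ⟶ D.obj r), coneValue θ φ k = coneValue θ' φ k) :
    θ = θ' :=
  QFunctor.hom_ext fun r => sSupHom.ext fun φ => sSupHom.ext (h r.unop φ)

/-- A criterion for `K(P, -)` to preserve a weighted colimit, in terms of elements. -/
theorem isWeightedColimit_homFrom_iff {Φ : QFunctor Rᵒᵖ Sup.{u}} {D : QFunctor R K} {c P : K}
    {η : Φ ⟶ homAlong D c} :
    IsWeightedColimit Φ (D.comp (homFrom P)) ((homFrom P).obj c)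
        (η ≫ homAlongApply D (homFrom P) c) ↔
      ∀ E : Sup.{u},
        (∀ f f' : sSupHom (P ⟶ c) E,
          (∀ (r : R) (φ : Φ.obj (.op r)) (h : P ⟶ D.obj r),
            f (h ≫ (sSupHom.toFun (NatTrans.app η (.op r)) φ : D.obj r ⟶ c)) =
              f' (h ≫ (sSupHom.toFun (NatTrans.app η (.op r)) φ : D.obj r ⟶ c))) → f = f') ∧
        ∀ θ : Φ ⟶ homAlong (D.comp (homFrom P)) E, ∃ f : sSupHom (P ⟶ c) E,
          ∀ (r : R) (φ : Φ.obj (.op r)) (h : P ⟶ D.obj r),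
            f (h ≫ (sSupHom.toFun (NatTrans.app η (.op r)) φ : D.obj r ⟶ c)) =
              coneValue θ φ h := by
  refine forall_congr' fun E => and_congr ⟨fun H f f' h => ?_, fun H f f' h => ?_⟩
    ⟨fun H θ => ?_, fun H θ => ?_⟩
  · exact H (cone_ext h)
  · exact H f f' fun r φ k => congrArg (fun θ => coneValue (P := P) θ φ k) h
  · obtain ⟨f, hf⟩ := H θ
    exact ⟨f, fun r φ k => congrArg (fun θ => coneValue (P := P) θ φ k) hf⟩
  · obtain ⟨f, hf⟩ := H θ
    exact ⟨f, cone_ext hf⟩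

/-- An object whose identity is a supremum of morphisms factoring through small-projective
objects is small-projective. -/
theorem isSmallProjective_of_iSup_eq_id {I : Type*} {P : K} {p : I → K}
    (hp : ∀ i, IsSmallProjective (p i)) (g : ∀ i, P ⟶ p i) (x : ∀ i, p i ⟶ P)
    (h : ⨆ i, g i ≫ x i = 𝟙 P) : IsSmallProjective P := by
  intro R _ _ Φ D c η hη
  rw [isWeightedColimit_homFrom_iff]
  have decomp : ∀ {Y : K} (y : P ⟶ Y), y = ⨆ i, g i ≫ x i ≫ y := fun y => by
    simp_rw [← Category.assoc]
    rw [← iSup_comp, h, Category.id_comp]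
  have hi := fun i => isWeightedColimit_homFrom_iff.mp (hp i R Φ D c η hη)
  refine fun E => ⟨fun f f' hf => ?_, fun θ => ?_⟩
  · have key : ∀ i, f.comp (precomp (g i) c) = f'.comp (precomp (g i) c) := fun i => by
      refine (hi i E).1 _ _ fun r φ k => ?_
      have := hf r φ (g i ≫ k)
      rwa [Category.assoc] at this
    ext y
    rw [decomp y, map_iSup, map_iSup]
    exact iSup_congr fun i => DFunLike.congr_fun (key i) (x i ≫ y)
  · choose f hf using fun i => (hi i E).2 (θ ≫ homAlongPrecomp D (g i) E)
    let F : ∀ i, (⟨P ⟶ c⟩ : Sup.{u}) ⟶ E := fun i => (f i).comp (precomp (x i) c)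
    refine ⟨(⨆ i, F i : (⟨P ⟶ c⟩ : Sup.{u}) ⟶ E), fun r φ k => ?_⟩
    refine (Sup.iSup_apply F _).trans ?_
    conv_rhs => rw [decomp k]
    rw [map_iSup]
    refine iSup_congr fun i => ?_
    refine Eq.trans (congrArg (f i) (Category.assoc _ _ _).symm) (hf i r φ (x i ≫ k))

end SmallProjective

/-! ### Representables are small-projective, and they generate -/

namespace RightModule

variable {Q : Type u} [Category.{u} Q] [Quantaloid Q]

/-- The Yoneda map `M(X) → Mod(Q(-, X), M)`. -/
def ofElementHom (M : RightModule Q) (X : Q) : sSupHom (M.obj (.op X)) (homInto X ⟶ M) where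
  toFun := M.ofElement
  map_sSup' := M.ofElement_sSup

/-- By Yoneda and coinduction, suplattice maps `Mod(Q(-, X), c) → E` are module maps `c ⟶ coinduced
X E`. The universal property at `E` is thus that of `η` at `coinduced X E`. -/
theorem isSmallProjective_homInto (X : Q) : IsSmallProjective (homInto X : RightModule Q) := by
  intro R _ _ Φ D (c : RightModule Q) η hη
  rw [isWeightedColimit_homFrom_iff]
  refine fun E => ⟨fun f f' hf => ?_, fun θ => ?_⟩
  · have key : toCoinduced c (f.comp (c.ofElementHom X)) =
        toCoinduced c (f'.comp (c.ofElementHom X)) := by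
      refine (hη (coinduced X E)).1 (QFunctor.hom_ext fun r => sSupHom.ext fun φ => ?_)
      let y : D.obj r.unop ⟶ c := sSupHom.toFun (NatTrans.app η r) φ
      change y ≫ toCoinduced c _ = y ≫ toCoinduced c _
      refine ofCoinduced_injective (sSupHom.ext fun m => ?_)
      change sSupHom.toFun (ofCoinduced _) m = sSupHom.toFun (ofCoinduced _) m
      rw [comp_ofCoinduced, comp_ofCoinduced, ofCoinduced_toCoinduced, ofCoinduced_toCoinduced]
      change f (c.ofElement _) = f' (c.ofElement _)
      rw [← ofElement_comp]
      exact hf _ φ _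
    ext y
    have h := congrArg (fun α => sSupHom.toFun (ofCoinduced α) (element y)) key
    simp only [ofCoinduced_toCoinduced] at h
    rw [← ofElement_element y]
    exact h
  · let V (r : R) : RightModule Q := D.obj r
    let ψ (r : R) : sSupHom (Φ.obj (.op r)) ((V r).obj (.op X) ⟶ E) :=
      (precomp (C := Sup.{u}) (Y := ⟨homInto X ⟶ V r⟩) (ofElementHom (V r) X) E).comp
        (NatTrans.app θ (.op r))
    -- The transpose of `θ`, to which the universal property of `η` applies.
    let θ' : Φ ⟶ homAlong D (coinduced X E) :=
      { app := fun r =>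
          { toFun := fun φ => toCoinduced (V r.unop) (ψ _ φ)
            map_sSup' := fun s => by
              rw [map_sSup, toCoinduced_sSup, Set.image_image] :
            sSupHom (Φ.obj r) (V r.unop ⟶ coinduced X E) }
        naturality := fun r s g => sSupHom.ext fun φ => by
          change toCoinduced (V s.unop) (ψ _ (sSupHom.toFun (Φ.map g) φ)) =
            D.map g.unop ≫ toCoinduced (V r.unop) (ψ _ φ)
          refine ofCoinduced_injective (sSupHom.ext fun m => ?_)
          change sSupHom.toFun (ofCoinduced _) m = sSupHom.toFun (ofCoinduced _) m
          rw [comp_ofCoinduced, ofCoinduced_toCoinduced, ofCoinduced_toCoinduced]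
          change coneValue θ _ (ofElement (V s.unop) m) =
            coneValue θ φ (ofElement (V r.unop) (ap (D.map g.unop) m))
          rw [← ofElement_comp]
          exact congrArg
            (fun k : (⟨homInto X ⟶ V s.unop⟩ : Sup.{u}) ⟶ E =>
              sSupHom.toFun k (ofElement (V s.unop) m))
            (congrArg (fun k => sSupHom.toFun k φ) (NatTrans.naturality θ g)) :
        NatTrans Φ.toFunctor (homAlong D (coinduced X E)).toFunctor }
    obtain ⟨n, hn⟩ := (hη (coinduced X E)).2 θ'
    refine ⟨{ toFun := fun h => sSupHom.toFun (ofCoinduced n) (element h)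
              map_sSup' := fun s => ?_ }, fun r φ h => ?_⟩
    · rw [element_sSup, sSupHom.map_sSup', Set.image_image]
    · have h1 := congrArg (fun α => sSupHom.toFun (NatTrans.app α (.op r)) φ) hn
      have h2 := congrArg (fun α : V r ⟶ coinduced X E =>
        sSupHom.toFun (ofCoinduced α) (element h)) h1
      refine h2.trans ?_
      change sSupHom.toFun (ofCoinduced (toCoinduced (V r) (ψ _ φ))) (element h) = _
      rw [ofCoinduced_toCoinduced]
      exact congrArg (coneValue θ φ) (ofElement_element h)

/-- The Yoneda embedding, as a homomorphism of quantaloids. -/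
def yoneda : QFunctor Q (RightModule Q) where
  obj := homInto
  map f := representableMap f
  map_id X := hom_ext fun _ f => Category.comp_id (X := _) (Y := X) f
  map_comp {X _ _} f g := hom_ext fun W h => (Category.assoc (W := W) (X := X) h f g).symm
  map_sSup {X Y} s := ofElement_sSup (homInto Y) (X := X) s

/-- The unit exhibiting a module as a colimit of representables weighted by itself. -/
def yonedaUnit (M : RightModule Q) : M ⟶ homAlong yoneda M :=
  { app := fun X => M.ofElementHom X.unop
    naturality := fun _ _ g => sSupHom.ext fun m => M.ofElement_act g.unop m :
    NatTrans M.toFunctor (homAlong yoneda M).toFunctor }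

/-- By Yoneda, a transformation `M ⟶ Mod(Q(-, X), E)` in `X` assigns to each element of `M` an
element of `E`; its naturality is compatibility with the action. -/
theorem isWeightedColimit_yonedaUnit (M : RightModule Q) :
    IsWeightedColimit M yoneda M M.yonedaUnit := by
  refine fun E => ⟨fun f f' h => hom_ext fun X m => ?_, fun θ => ?_⟩
  · have h' : M.ofElement m ≫ f = M.ofElement m ≫ f' :=
      congrArg (fun α => sSupHom.toFun (NatTrans.app α (.op X)) m) h
    rw [← M.element_ofElement m, ← element_comp, h', element_comp]
  · let v {X : Q} (m : M.obj (.op X)) : homInto X ⟶ E :=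
      sSupHom.toFun (NatTrans.app θ (.op X)) m
    let f : M ⟶ E :=
      { app := fun X =>
          { toFun := fun m => element (v m)
            map_sSup' := fun s => by
              have : v (sSup s) = sSup (v '' s) := sSupHom.map_sSup' (NatTrans.app θ X) s
              rw [this, element_sSup, Set.image_image] : sSupHom (M.obj X) (E.obj X) }
        naturality := fun X Y g => sSupHom.ext fun m => by
          have h : v (M.act g.unop m) = representableMap g.unop ≫ v m :=
            congrArg (fun k => sSupHom.toFun k m) (NatTrans.naturality θ g)
          exact (congrArg element h).trans (element_representableMap_comp g.unop (v m)) :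
        NatTrans M.toFunctor E.toFunctor }
    refine ⟨f, QFunctor.hom_ext fun X => sSupHom.ext fun m => ?_⟩
    change M.ofElement m ≫ f = v m
    rw [ofElement_comp]
    exact ofElement_element (v m)

/-! ### Dual bases and the equivalences -/

/-- A dual basis of a module: morphisms to and from representables whose composites have the
identity as their supremum. -/
def HasDualBasis (F : RightModule Q) : Prop :=
  ∃ (I : Type u) (X : I → Q) (g : ∀ i, F ⟶ homInto (X i)) (x : ∀ i, homInto (X i) ⟶ F),
    ⨆ i, g i ≫ x i = 𝟙 F

theorem HasDualBasis.isSmallProjective {F : RightModule Q} (h : HasDualBasis F) :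
    IsSmallProjective F := by
  obtain ⟨I, X, g, x, h⟩ := h
  exact isSmallProjective_of_iSup_eq_id (fun i => isSmallProjective_homInto (X i)) g x h

theorem hasDualBasis_of_isSmallProjective {F : RightModule Q} (hF : IsSmallProjective F) :
    HasDualBasis F := by
  -- All composites through a representable that lie below the identity; since `Q` is small, `I` is
  -- a small set.
  let I := Σ X : Q, {p : (F ⟶ homInto X) × F.obj (.op X) // p.1 ≫ F.ofElement p.2 ≤ 𝟙 F}
  refine ⟨I, fun i => i.1, fun i => i.2.1.1, fun i => F.ofElement i.2.1.2, ?_⟩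
  refine le_antisymm (iSup_le fun i => i.2.2) ?_
  set j : F ⟶ F := ⨆ i : I, i.2.1.1 ≫ F.ofElement i.2.1.2 with hj
  have hc := isWeightedColimit_homFrom_iff.mp
    (hF Q F yoneda F F.yonedaUnit F.isWeightedColimit_yonedaUnit) ⟨ULift.{u} Prop⟩
  -- Only the uniqueness half of preservation is needed: the two test maps agree on every `g ≫
  -- F.ofElement m`, since such a composite below `𝟙 F` is a member of the family defining `j`.
  have key := hc.1 (Sup.notLe (L := ⟨F ⟶ F⟩) (𝟙 F)) (Sup.notLe (L := ⟨F ⟶ F⟩) j)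
    fun X m g => by
      refine Sup.notLe_eq_iff.mpr ⟨fun h => ?_, fun h => h.trans (iSup_le fun i => i.2.2)⟩
      exact le_iSup (fun i : I => i.2.1.1 ≫ F.ofElement i.2.1.2) ⟨X, (g, m), h⟩
  exact (Sup.notLe_eq_iff.mp (DFunLike.congr_fun key (𝟙 F))).mp le_rfl

theorem HasDualBasis.projective {F : RightModule Q} (h : HasDualBasis F) : Projective F := by
  obtain ⟨I, X, g, x, h⟩ := h
  refine ⟨fun {B} {C} f e _ => ?_⟩
  -- By Yoneda, lifting `x i ≫ f` through `e` only requires a preimage of its element at `X i`.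
  choose c hc using fun i => surjective_of_epi e (X i) (element (x i ≫ f))
  refine ⟨⨆ i, g i ≫ ofElement _ (c i), ?_⟩
  rw [iSup_comp, ← Category.id_comp f, ← h, iSup_comp]
  refine iSup_congr fun i => ?_
  rw [Category.assoc, Category.assoc, ofElement_comp, ← ofElement_element (x i ≫ f)]
  exact congrArg (fun m => g i ≫ ofElement _ m) (hc i)

theorem hasDualBasis_of_isRetract {F : RightModule Q} (h : IsRetractOfSumOfRepresentables F) :
    HasDualBasis F := by
  obtain ⟨I, X, S, ⟨hS⟩, ⟨ρ⟩⟩ := h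
  obtain ⟨p, hp⟩ := exists_iSup_comp_inj_eq_id hS
  refine ⟨I, X, fun i => ρ.i ≫ p i, fun i => S.inj i ≫ ρ.r, ?_⟩
  rw [← ρ.retract]
  conv_rhs => rw [← Category.id_comp ρ.r, ← hp, iSup_comp, comp_iSup]
  exact iSup_congr fun i => by simp only [Category.assoc]

/-- The pointwise product serves as the sum, by `isColimitOfIsProduct`. -/
theorem exists_sum (I : Type u) (X : I → Q) :
    ∃ S : Limits.Cofan fun i => (homInto (X i) : RightModule Q), Nonempty (Limits.IsColimit S) :=
  ⟨_, ⟨isColimitOfIsProduct (piFanIsLimit _)⟩⟩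

theorem HasDualBasis.isRetract {F : RightModule Q} (h : HasDualBasis F) :
    IsRetractOfSumOfRepresentables F := by
  obtain ⟨I, X, g, x, h⟩ := h
  obtain ⟨S, ⟨hS⟩⟩ := exists_sum I X
  refine ⟨I, X, S, ⟨hS⟩, ⟨⟨⨆ i, g i ≫ S.inj i, Limits.Cofan.IsColimit.desc hS x, ?_⟩⟩⟩
  rw [iSup_comp, ← h]
  refine iSup_congr fun i => ?_
  rw [Category.assoc, Limits.Cofan.IsColimit.fac]

theorem isRetract_of_projective {F : RightModule Q} (hF : Projective F) :
    IsRetractOfSumOfRepresentables F := by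
  -- With one summand for every element of `F`, the map `r` hits every element; it is therefore epi,
  -- and projectivity splits it.
  obtain ⟨S, ⟨hS⟩⟩ := exists_sum (Σ X : Q, F.obj (.op X)) fun i => i.1
  let r : S.pt ⟶ F := Limits.Cofan.IsColimit.desc hS fun i => F.ofElement i.2
  have hr : ∀ (X : Q) (m : F.obj (.op X)), S.inj ⟨X, m⟩ ≫ r = F.ofElement m := fun X m =>
    Limits.Cofan.IsColimit.fac hS _ _
  have : Epi r := ⟨fun a b hab => hom_ext fun X m => by
    rw [← F.element_ofElement m, ← element_comp, ← element_comp, ← hr,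
      Category.assoc, hab, Category.assoc]⟩
  exact ⟨_, _, S, ⟨hS⟩, ⟨⟨Projective.factorThru (𝟙 F) r, r, Projective.factorThru_comp _ _⟩⟩⟩

end RightModule

end Quantaloid

theorem propositiona8 {Q : Type u} [Category.{u} Q] [Quantaloid Q]
    (F : Quantaloid.RightModule Q) :
    List.TFAE [
      CategoryTheory.Projective F,
      Quantaloid.IsRetractOfSumOfRepresentables F,
      Quantaloid.IsSmallProjective F] := by
  tfae_have 1 → 2 := Quantaloid.RightModule.isRetract_of_projective
  tfae_have 2 → 1 := fun h => (Quantaloid.RightModule.hasDualBasis_of_isRetract h).projective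
  tfae_have 2 → 3 := fun h => (Quantaloid.RightModule.hasDualBasis_of_isRetract h).isSmallProjective
  tfae_have 3 → 2 := fun h =>
    (Quantaloid.RightModule.hasDualBasis_of_isSmallProjective h).isRetract
  tfae_finish
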